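/- Let $n\ge 1$, let $a_0,\dots,a_n,\ b_0,\dots,b_n,\ c_0,\dots,c_n$ be arbitrary complex numbers, and put $P_n(x)=\sum_{r=0}^n a_rx^r$, $Q_n(x)=\sum_{r=0}^n b_rx^r$, $T_n(x)=\sum_{r=0}^n c_rx^r$. For $s\ge 3$ the function $\frac{P_n(x_1)Q_n(x_2)T_n(x_3)}{1-x_1x_2\cdots x_s}$ is integrable on $[0,1]^s$; let $$I_s=\int_0^1\!\!\cdots\!\int_0^1\frac{P_n(x_1)Q_n(x_2)T_n(x_3)}{1-x_1x_2\cdots x_s}\,dx_1\cdots dx_s .$$ Write $H_r^{(m)}=\sum_{k=1}^r k^{-m}$, $H_r=H_r^{(1)}$, $H_0^{(m)}=0$, $d_r=a_rb_rc_r$ and $S_{\mu\nu\lambda}=a_\mu b_\nu c_\lambda+b_\mu c_\nu a_\lambda+c_\mu a_\nu b_\lambda$. For a function $w$ on $\{0,\dots,n\}$ put $$\mathcal T[w]=\sum_{r=2}^n\sum_{l=1}^{r-1}\sum_{i=0}^{l-1}(S_{irl}+S_{ilr})\left(\frac{w(i)}{(i-r)(i-l)}+\frac{w(r)}{(r-i)(r-l)}+\frac{w(l)}{(l-i)(l-r)}\right),$$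 and for $p\ge1$ let $h_p(i)=H_i/i^p$, $e_p(i)=1/i^p$ for $i\ge1$, and $h_p(0)=e_p(0)=0$. Then $$I_3=A_{3,3}\zeta(3)-A_{3,2}\zeta(2)-A_{3},\qquad I_4=A_{4,4}\zeta(4)+A_{4,3}\zeta(3)-A_{4,2}\zeta(2)-A_4,$$ and for every $s\ge 5$ $$I_s=A_{1,s}\zeta(s)+A_{1,s-1}\zeta(s-1)+\dots+A_{1,3}\zeta(3)-A_{1,2}\zeta(2)-A_1,$$ with the following coefficients. For $s=3$: $$A_{3,3}=\sum_{r=0}^n d_r,\qquad A_{3,2}=\sum_{r=1}^n\sum_{l=0}^{r-1}\frac{S_{rrl}-S_{llr}}{r-l},$$ $$A_3=\sum_{r=1}^n d_rH_r^{(3)}-\sum_{r=1}^n\sum_{l=0}^{r-1}\left(\frac{S_{rrl}H^{(2)}_r-S_{llr}H^{(2)}_l}{r-l}+(S_{rrl}-S_{llr})\frac{H_r-H_l}{(r-l)^2}\right)+\mathcal T[H].$$ For $s=4$: $A_{4,4}=d_0$, $A_{4,3}=\sum_{r=1}^n\frac{S_{00r}-d_r}{r}$, $$A_{4,2}=\sum_{r=1}^n\frac{d_r+S_{00r}-2S_{0rr}}{r^2}+\sum_{r=2}^n\sum_{l=1}^{r-1}\left(\frac{S_{0rl}+S_{0lr}}{r-l}\Big(\frac1r-\frac1l\Big)-\frac1{r-l}\Big(\frac{S_{rrl}}r-\frac{S_{llr}}l\Big)\right),$$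 $$A_4=\sum_{r=1}^n\left(\frac{2S_{0rr}-d_r-S_{00r}}{r^3}H_r+\frac{S_{0rr}-d_r}{r^2}H^{(2)}_r-\frac{d_r}{r}H^{(3)}_r\right)$$ $$+\sum_{r=2}^n\sum_{l=1}^{r-1}\left(\frac{S_{rrl}-S_{llr}}{(r-l)^2}\Big(\frac{H_r}r-\frac{H_l}l\Big)+\frac1{r-l}\Big(\frac{S_{rrl}H_r}{r^2}-\frac{S_{llr}H_l}{l^2}\Big)+\frac1{r-l}\Big(\frac{S_{rrl}H^{(2)}_r}{r}-\frac{S_{llr}H^{(2)}_l}{l}\Big)\right)-\mathcal T[h_1].$$ For $s\ge5$: $A_{1,s}=d_0$, $A_{1,s-1}=\sum_{r=1}^n\frac{S_{00r}}r$. Put $$B_2=\sum_{r=1}^n\frac{S_{0rr}-S_{00r}}{r^2}-\sum_{r=2}^n\sum_{l=1}^{r-1}\frac{S_{0lr}+S_{0rl}}{r-l}\Big(\frac1r-\frac1l\Big),$$ and, for $j\ge3$, $$B_j=(-1)^{j-1}\Bigg(\sum_{r=1}^n\frac{S_{00r}-(j-1)S_{0rr}+\frac{(j-2)(j-1)}2d_r}{r^j}$$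 $$+\sum_{r=2}^n\sum_{l=1}^{r-1}\left(\frac{S_{llr}-S_{rrl}}{(r-l)^2}\Big(\frac1{r^{j-2}}-\frac1{l^{j-2}}\Big)+\frac{j-2}{r-l}\Big(\frac{S_{llr}}{l^{j-1}}-\frac{S_{rrl}}{r^{j-1}}\Big)\right)+\mathcal T[e_{j-2}]\Bigg).$$ Then $A_{1,s-j}=B_j$ for $2\le j\le s-4$; for $j=s-3$ $$A_{1,3}=B_{s-3}+(-1)^{s-3}\sum_{r=1}^n\frac{d_r}{r^{s-3}};$$ and $$A_{1,2}=(-1)^s\Bigg(\sum_{r=1}^n\frac{S_{00r}-(s-2)S_{0rr}+\frac{(s-2)(s-3)}2d_r}{r^{s-2}}$$ $$+\sum_{r=2}^n\sum_{l=1}^{r-1}\left(\frac{S_{llr}-S_{rrl}}{(r-l)^2}\Big(\frac1{r^{s-4}}-\frac1{l^{s-4}}\Big)+\frac{s-3}{r-l}\Big(\frac{S_{llr}}{l^{s-3}}-\frac{S_{rrl}}{r^{s-3}}\Big)\right)+\mathcal T[e_{s-4}]\Bigg),$$ $$A_1=(-1)^s\Bigg(\sum_{r=1}^n\left(\frac{-S_{00r}+(s-2)S_{0rr}-\frac{(s-2)(s-3)}2d_r}{r^{s-1}}H_r-\frac{(s-3)d_r-S_{0rr}}{r^{s-2}}H^{(2)}_r-\frac{d_r}{r^{s-3}}H^{(3)}_r\right)$$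 $$-\sum_{r=2}^n\sum_{l=1}^{r-1}\left(\frac1{r-l}\Big(\frac{H^{(2)}_lS_{llr}}{l^{s-3}}-\frac{H^{(2)}_rS_{rrl}}{r^{s-3}}\Big)+\frac{s-3}{r-l}\Big(\frac{H_lS_{llr}}{l^{s-2}}-\frac{H_rS_{rrl}}{r^{s-2}}\Big)+\frac{S_{llr}-S_{rrl}}{(r-l)^2}\Big(\frac{H_r}{r^{s-3}}-\frac{H_l}{l^{s-3}}\Big)\right)-\mathcal T[h_{s-3}]\Bigg).$$ -/

import Mathlib

open Finset MeasureTheory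

noncomputable section

namespace ZetaForms

/-- Generalized harmonic number `H_n^{(m)} = ∑_{k=1}^n 1/k^m`. -/
def H (m n : ℕ) : ℂ := ∑ k ∈ Icc 1 n, 1 / (k : ℂ) ^ m

/-- The polynomial function `a_0 + a_1 x + ⋯ + a_n x^n`. -/
def poly (n : ℕ) (a : ℕ → ℂ) (x : ℂ) : ℂ := ∑ r ∈ range (n + 1), a r * x ^ r

/-- The integrand `P_n(x_1) Q_n(x_2) T_n(x_3) / (1 - x_1 x_2 ⋯ x_s)`, for `s ≥ 3`;
the coordinates are indexed from `0`. -/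
def integrand (n : ℕ) (a b c : ℕ → ℂ) (s : ℕ) (hs : 3 ≤ s) (x : Fin s → ℝ) : ℂ :=
  poly n a (x ⟨0, by omega⟩) * poly n b (x ⟨1, by omega⟩) * poly n c (x ⟨2, by omega⟩) /
    (1 - ∏ i, (x i : ℂ))

/-- The integral `I_s` over the unit cube `[0,1]^s`. -/
def I (n : ℕ) (a b c : ℕ → ℂ) (s : ℕ) (hs : 3 ≤ s) : ℂ :=
  ∫ x in Set.Icc (0 : Fin s → ℝ) 1, integrand n a b c s hs x

/-- `S_{μνλ} = a_μ b_ν c_λ + b_μ c_ν a_λ + c_μ a_ν b_λ`. -/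
def S (a b c : ℕ → ℂ) (μ ν l : ℕ) : ℂ :=
  a μ * b ν * c l + b μ * c ν * a l + c μ * a ν * b l

/-- The weight `u_i / i^p`, where the value at `i = 0` is omitted (read as `0`). -/
def weight (u : ℕ → ℂ) (p i : ℕ) : ℂ := if i = 0 then 0 else u i / (i : ℂ) ^ p

/-- The triple sum over `0 ≤ i < l < r ≤ n` of
`(S_{irl} + S_{ilr}) (w_i/((i-r)(i-l)) + w_r/((r-i)(r-l)) + w_l/((l-i)(l-r)))`. -/
def tripleSum (n : ℕ) (a b c : ℕ → ℂ) (w : ℕ → ℂ) : ℂ :=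
  ∑ r ∈ Icc 2 n, ∑ l ∈ Icc 1 (r - 1), ∑ i ∈ range l,
    (S a b c i r l + S a b c i l r) *
      (w i / (((i : ℂ) - r) * ((i : ℂ) - l)) + w r / (((r : ℂ) - i) * ((r : ℂ) - l)) +
        w l / (((l : ℂ) - i) * ((l : ℂ) - r)))

/-! ### The case `s = 3` -/

/-- Coefficient of `ζ(3)` in `I_3`. -/
def A33 (n : ℕ) (a b c : ℕ → ℂ) : ℂ := ∑ r ∈ range (n + 1), a r * b r * c r

/-- Minus the coefficient of `ζ(2)` in `I_3`. -/
def A32 (n : ℕ) (a b c : ℕ → ℂ) : ℂ :=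
  ∑ r ∈ Icc 1 n, ∑ l ∈ range r, (S a b c r r l - S a b c l l r) / ((r : ℂ) - l)

/-- Minus the constant term of `I_3`. -/
def A3 (n : ℕ) (a b c : ℕ → ℂ) : ℂ :=
  ∑ r ∈ Icc 1 n, a r * b r * c r * H 3 r
  - ∑ r ∈ Icc 1 n, ∑ l ∈ range r,
      ((S a b c r r l * H 2 r - S a b c l l r * H 2 l) / ((r : ℂ) - l)
        + (S a b c r r l - S a b c l l r) * ((H 1 r - H 1 l) / ((r : ℂ) - l) ^ 2))
  + tripleSum n a b c (H 1)

/-! ### The case `s = 4` -/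

/-- Coefficient of `ζ(4)` in `I_4`. -/
def A44 (a b c : ℕ → ℂ) : ℂ := a 0 * b 0 * c 0

/-- Coefficient of `ζ(3)` in `I_4`. -/
def A43 (n : ℕ) (a b c : ℕ → ℂ) : ℂ :=
  ∑ r ∈ Icc 1 n, (S a b c 0 0 r - a r * b r * c r) / (r : ℂ)

/-- Minus the coefficient of `ζ(2)` in `I_4`. -/
def A42 (n : ℕ) (a b c : ℕ → ℂ) : ℂ :=
  ∑ r ∈ Icc 1 n, (a r * b r * c r + S a b c 0 0 r - 2 * S a b c 0 r r) / (r : ℂ) ^ 2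
  + ∑ r ∈ Icc 2 n, ∑ l ∈ Icc 1 (r - 1),
      ((S a b c 0 r l + S a b c 0 l r) / ((r : ℂ) - l) * (1 / (r : ℂ) - 1 / (l : ℂ))
        - 1 / ((r : ℂ) - l) * (S a b c r r l / (r : ℂ) - S a b c l l r / (l : ℂ)))

/-- Minus the constant term of `I_4`. -/
def A4 (n : ℕ) (a b c : ℕ → ℂ) : ℂ :=
  ∑ r ∈ Icc 1 n,
      ((2 * S a b c 0 r r - a r * b r * c r - S a b c 0 0 r) / (r : ℂ) ^ 3 * H 1 r
        + (S a b c 0 r r - a r * b r * c r) / (r : ℂ) ^ 2 * H 2 r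
        - a r * b r * c r / (r : ℂ) * H 3 r)
  + ∑ r ∈ Icc 2 n, ∑ l ∈ Icc 1 (r - 1),
      ((S a b c r r l - S a b c l l r) / ((r : ℂ) - l) ^ 2 * (H 1 r / (r : ℂ) - H 1 l / (l : ℂ))
        + 1 / ((r : ℂ) - l) *
            (S a b c r r l * (H 1 r / (r : ℂ) ^ 2) - S a b c l l r * (H 1 l / (l : ℂ) ^ 2))
        + 1 / ((r : ℂ) - l) *
            (S a b c r r l * (H 2 r / (r : ℂ)) - S a b c l l r * (H 2 l / (l : ℂ))))
  - tripleSum n a b c (weight (H 1) 1)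

/-! ### The case `s ≥ 5` -/

/-- The coefficient with index `s - 2`, without the contribution special to `ζ(3)`. -/
def second (n : ℕ) (a b c : ℕ → ℂ) : ℂ :=
  ∑ r ∈ Icc 1 n, (S a b c 0 r r - S a b c 0 0 r) / (r : ℂ) ^ 2
  - ∑ r ∈ Icc 2 n, ∑ l ∈ Icc 1 (r - 1),
      (S a b c 0 l r + S a b c 0 r l) / ((r : ℂ) - l) * (1 / (r : ℂ) - 1 / (l : ℂ))

/-- The coefficient with index `s - j`, `3 ≤ j ≤ s - 3`, without the contribution
special to `ζ(3)`. -/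
def general (n : ℕ) (a b c : ℕ → ℂ) (j : ℕ) : ℂ :=
  (-1) ^ (j - 1) *
    (∑ r ∈ Icc 1 n,
        (S a b c 0 0 r - ((j : ℂ) - 1) * S a b c 0 r r
          + ((j : ℂ) - 2) * ((j : ℂ) - 1) / 2 * (a r * b r * c r)) / (r : ℂ) ^ j
      + ∑ r ∈ Icc 2 n, ∑ l ∈ Icc 1 (r - 1),
        ((S a b c l l r - S a b c r r l) / ((r : ℂ) - l) ^ 2 *
            (1 / (r : ℂ) ^ (j - 2) - 1 / (l : ℂ) ^ (j - 2))
          + ((j : ℂ) - 2) / ((r : ℂ) - l) *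
            (S a b c l l r / (l : ℂ) ^ (j - 1) - S a b c r r l / (r : ℂ) ^ (j - 1)))
      + tripleSum n a b c (weight (fun _ => 1) (j - 2)))

/-- The additional contribution to the coefficient of `ζ(3)`. -/
def extra (n : ℕ) (a b c : ℕ → ℂ) (s : ℕ) : ℂ :=
  (-1) ^ (s - 3) * ∑ r ∈ Icc 1 n, a r * b r * c r / (r : ℂ) ^ (s - 3)

/-- Minus the coefficient of `ζ(2)` in `I_s`, `s ≥ 5`. -/
def A12 (n : ℕ) (a b c : ℕ → ℂ) (s : ℕ) : ℂ :=
  (-1) ^ s *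
    (∑ r ∈ Icc 1 n,
        (S a b c 0 0 r - ((s : ℂ) - 2) * S a b c 0 r r
          + ((s : ℂ) - 2) * ((s : ℂ) - 3) / 2 * (a r * b r * c r)) / (r : ℂ) ^ (s - 2)
      + ∑ r ∈ Icc 2 n, ∑ l ∈ Icc 1 (r - 1),
        ((S a b c l l r - S a b c r r l) / ((r : ℂ) - l) ^ 2 *
            (1 / (r : ℂ) ^ (s - 4) - 1 / (l : ℂ) ^ (s - 4))
          + ((s : ℂ) - 3) / ((r : ℂ) - l) *
            (S a b c l l r / (l : ℂ) ^ (s - 3) - S a b c r r l / (r : ℂ) ^ (s - 3)))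
      + tripleSum n a b c (weight (fun _ => 1) (s - 4)))

/-- The coefficients `A_{1,m}`, `2 ≤ m ≤ s`, for `s ≥ 5`. -/
def A1m (n : ℕ) (a b c : ℕ → ℂ) (s m : ℕ) : ℂ :=
  if m = s then a 0 * b 0 * c 0
  else if m = s - 1 then ∑ r ∈ Icc 1 n, S a b c 0 0 r / (r : ℂ)
  else if m = 2 then A12 n a b c s
  else (if m = s - 2 then second n a b c else general n a b c (s - m))
    + (if m = 3 then extra n a b c s else 0)

/-- Minus the constant term `A_1` of `I_s`, for `s ≥ 5`. -/
def A1 (n : ℕ) (a b c : ℕ → ℂ) (s : ℕ) : ℂ :=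
  (-1) ^ s *
    (∑ r ∈ Icc 1 n,
        ((-S a b c 0 0 r + ((s : ℂ) - 2) * S a b c 0 r r
            - ((s : ℂ) - 2) * ((s : ℂ) - 3) / 2 * (a r * b r * c r)) / (r : ℂ) ^ (s - 1) * H 1 r
          - (((s : ℂ) - 3) * (a r * b r * c r) - S a b c 0 r r) / (r : ℂ) ^ (s - 2) * H 2 r
          - a r * b r * c r / (r : ℂ) ^ (s - 3) * H 3 r)
      - ∑ r ∈ Icc 2 n, ∑ l ∈ Icc 1 (r - 1),
        (1 / ((r : ℂ) - l) *
            (H 2 l * S a b c l l r / (l : ℂ) ^ (s - 3) - H 2 r * S a b c r r l / (r : ℂ) ^ (s - 3))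
          + ((s : ℂ) - 3) / ((r : ℂ) - l) *
            (H 1 l * S a b c l l r / (l : ℂ) ^ (s - 2) - H 1 r * S a b c r r l / (r : ℂ) ^ (s - 2))
          + (S a b c l l r - S a b c r r l) / ((r : ℂ) - l) ^ 2 *
            (H 1 r / (r : ℂ) ^ (s - 3) - H 1 l / (l : ℂ) ^ (s - 3)))
      - tripleSum n a b c (weight (H 1) (s - 3)))

end ZetaForms

end

namespace ZetaForms

/-! Expanding the kernel in a geometric series and integrating termwise turns `I_s` into the sum
over `x = 1, 2, …` of `∑ a_i b_j c_l / ((x+i)(x+j)(x+l) x^(s-3))`; absolute convergence comes from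
`geometric_kernel`, the terms from `integrand_and_hasSum`.

Sorting the index triples by coincidences and taking partial fractions in the shifts alone
(`combination_partial_fractions`) leaves a finite expression, `combination`, linear in three
families of series `∑ 1/((x+r)^p x^(s-3))`, `p = 1, 2, 3`. For `s = 3` the family `p = 1` diverges,
but the coefficients of the simple poles add up to zero, so a common term `1/x` may be subtracted
from each, which produces harmonic numbers.

For `s ≥ 4` the identity behind `hasSum_partial_fractions` lowers the exponents recursively and
yields closed forms in zeta values and harmonic numbers. Linearity (`combination_series`) then
collects the coefficient of each zeta value. The values at 2 and 3 receive additional terms because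
the recursions for double and triple poles start from shifted series for `ζ(2)` and `ζ(3)`. -/

/-! ### Termwise integration of the geometric series over the cube -/

lemma restrict_cube (s : ℕ) :
    (volume : Measure (Fin s → ℝ)).restrict (Set.Icc 0 1) =
      Measure.pi fun _ : Fin s => (volume : Measure ℝ).restrict (Set.Icc 0 1) := by
  rw [← Measure.restrict_pi_pi, ← volume_pi, Set.pi_univ_Icc]
  rfl

lemma integral_Icc_pow (k : ℕ) : ∫ x in Set.Icc (0 : ℝ) 1, x ^ k = 1 / ((k : ℝ) + 1) := by
  rw [integral_Icc_eq_integral_Ioc, ← intervalIntegral.integral_of_le zero_le_one, integral_pow]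
  simp

/-- A product of continuous functions of one variable is integrable against the kernel
`1 / (1 - ∏ x_i)` over the cube, and the integral is computed termwise from the geometric
series. -/
lemma geometric_kernel {s : ℕ} (hs : 2 ≤ s) (φ : Fin s → ℝ → ℂ) (hφ : ∀ i, Continuous (φ i)) :
    IntegrableOn (fun x : Fin s → ℝ => (∏ i, φ i (x i)) / (1 - ∏ i, (x i : ℂ)))
        (Set.Icc 0 1) ∧
      HasSum (fun k : ℕ => ∏ i, ∫ x in Set.Icc (0 : ℝ) 1, φ i x * (x : ℂ) ^ k)
        (∫ x in Set.Icc (0 : Fin s → ℝ) 1, (∏ i, φ i (x i)) / (1 - ∏ i, (x i : ℂ))) := by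
  set F : ℕ → (Fin s → ℝ) → ℂ := fun k x => ∏ i, (φ i (x i) * (x i : ℂ) ^ k) with hF
  set g : (Fin s → ℝ) → ℂ := fun x => (∏ i, φ i (x i)) / (1 - ∏ i, (x i : ℂ)) with hg
  have hcont : ∀ k i, Continuous fun x : ℝ => φ i x * (x : ℂ) ^ k := fun k i => by
    have := hφ i
    fun_prop
  have hFint : ∀ k, IntegrableOn (F k) (Set.Icc 0 1) := fun k => by
    rw [IntegrableOn, restrict_cube]
    exact Integrable.fintype_prod fun i => ((hcont k i).integrableOn_Icc)
  have hFnorm : ∀ k, ∫ x in Set.Icc (0 : Fin s → ℝ) 1, ‖F k x‖ =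
      ∏ i, ∫ x in Set.Icc (0 : ℝ) 1, ‖φ i x * (x : ℂ) ^ k‖ := fun k => by
    simp only [hF, norm_prod]
    rw [restrict_cube]
    exact integral_fintype_prod_eq_prod (𝕜 := ℝ) fun i x => ‖φ i x * (x : ℂ) ^ k‖
  have hbound : ∀ i, ∃ C, ∀ x ∈ Set.Icc (0 : ℝ) 1, ‖φ i x‖ ≤ C := fun i =>
    isCompact_Icc.exists_bound_of_continuousOn (hφ i).continuousOn
  choose C hC using hbound
  have hsum : Summable fun k => ∫ x in Set.Icc (0 : Fin s → ℝ) 1, ‖F k x‖ := by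
    -- Each coordinate contributes at most `C i / (k + 1)`, so the `k`-th term is `O(k^(-s))`; this
    -- is where `2 ≤ s` is needed.
    have h1 : Summable fun k : ℕ => (∏ i, C i) * (1 / ((k : ℝ) + 1) ^ s) := by
      have := (summable_nat_add_iff 1).2 (Real.summable_one_div_nat_pow.2 (by omega : 1 < s))
      refine Summable.mul_left _ ?_
      simpa using this
    refine Summable.of_nonneg_of_le (fun k => integral_nonneg fun x => norm_nonneg _)
      (fun k => ?_) h1
    rw [hFnorm k]
    calc _ ≤ ∏ i, (C i * (1 / ((k : ℝ) + 1))) := by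
          refine prod_le_prod (fun i _ => integral_nonneg fun x => norm_nonneg _) fun i _ => ?_
          rw [← integral_Icc_pow k, ← integral_const_mul]
          refine setIntegral_mono_on (hcont k i).norm.integrableOn_Icc
            (Continuous.integrableOn_Icc (by fun_prop)) measurableSet_Icc fun x hx => ?_
          rw [norm_mul, norm_pow, Complex.norm_real, Real.norm_of_nonneg hx.1]
          exact mul_le_mul_of_nonneg_right (hC i x hx) (pow_nonneg hx.1 k)
      _ = _ := by rw [prod_mul_distrib]; simp
  have hae : ∀ᵐ x ∂(volume : Measure (Fin s → ℝ)).restrict (Set.Icc 0 1),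
      HasSum (fun k => F k x) (g x) := by
    have h1 : ∀ᵐ y ∂(volume : Measure ℝ).restrict (Set.Icc 0 1), 0 ≤ y ∧ y < 1 := by
      have h2 : ∀ᵐ y ∂(volume : Measure ℝ).restrict (Set.Icc 0 1), y ≠ 1 :=
        ae_restrict_of_ae (Measure.ae_ne volume 1)
      filter_upwards [h2, ae_restrict_mem measurableSet_Icc] with y hy hy'
      exact ⟨hy'.1, lt_of_le_of_ne hy'.2 hy⟩
    have h3 : ∀ᵐ x ∂(volume : Measure (Fin s → ℝ)).restrict (Set.Icc 0 1),
        ∀ i, 0 ≤ x i ∧ x i < 1 := by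
      rw [restrict_cube]
      exact Filter.eventually_all.2 fun i =>
        (Measure.tendsto_eval_ae_ae (μ := fun _ : Fin s => (volume : Measure ℝ).restrict
          (Set.Icc 0 1)) (i := i)).eventually h1
    filter_upwards [h3] with x hx
    have hlt : ‖∏ i, (x i : ℂ)‖ < 1 := by
      -- One factor strictly below 1 suffices, the others being at most 1.
      rw [norm_prod, ← mul_prod_erase univ _ (mem_univ (⟨0, by omega⟩ : Fin s))]
      refine (mul_le_of_le_one_right (norm_nonneg _) (prod_le_one (fun i _ => norm_nonneg _)
        fun i _ => ?_)).trans_lt ?_ <;>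
      rw [Complex.norm_real, Real.norm_of_nonneg (hx _).1]
      · exact (hx _).2.le
      · exact (hx _).2
    have := (hasSum_geometric_of_norm_lt_one hlt).mul_left (∏ i, φ i (x i))
    simpa only [hF, hg, prod_mul_distrib, prod_pow, div_eq_mul_inv] using this
  have hmeas : AEStronglyMeasurable g ((volume : Measure (Fin s → ℝ)).restrict (Set.Icc 0 1)) := by
    have h1 : ∀ i, Measurable (φ i) := fun i => (hφ i).measurable
    refine Measurable.aestronglyMeasurable (Measurable.div ?_ ?_)
    · exact Finset.measurable_fun_prod _ fun i _ => (h1 i).comp (measurable_pi_apply i)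
    · exact Continuous.measurable (by fun_prop)
  refine ⟨⟨hmeas, ?_⟩, ?_⟩
  -- Tonelli: the integral of `‖g‖` is at most the sum of the integrals of the `‖F k‖`, already
  -- known to be finite.
  · have h1 : ∫⁻ x in Set.Icc (0 : Fin s → ℝ) 1, ‖g x‖ₑ ≤
        ∫⁻ x in Set.Icc (0 : Fin s → ℝ) 1, ∑' k, ‖F k x‖ₑ := by
      refine lintegral_mono_ae ?_
      filter_upwards [hae] with x hx
      rw [← hx.tsum_eq]
      exact enorm_tsum_le_tsum_enorm
    refine h1.trans_lt ?_
    rw [lintegral_tsum fun k => (hFint k).1.enorm]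
    have h2 : ∀ k, ∫⁻ x in Set.Icc (0 : Fin s → ℝ) 1, ‖F k x‖ₑ =
        ENNReal.ofReal (∫ x in Set.Icc (0 : Fin s → ℝ) 1, ‖F k x‖) := fun k => by
      rw [ofReal_integral_norm_eq_lintegral_enorm (hFint k)]
    simp only [h2]
    rw [← ENNReal.ofReal_tsum_of_nonneg (fun k => integral_nonneg fun x => norm_nonneg _) hsum]
    exact ENNReal.ofReal_lt_top
  · have h1 := hasSum_integral_of_summable_integral_norm hFint hsum
    have h2 : ∫ x in Set.Icc (0 : Fin s → ℝ) 1, ∑' k, F k x =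
        ∫ x in Set.Icc (0 : Fin s → ℝ) 1, g x := by
      refine integral_congr_ae ?_
      filter_upwards [hae] with x hx using hx.tsum_eq
    rw [h2] at h1
    have h3 : (fun k => ∫ x in Set.Icc (0 : Fin s → ℝ) 1, F k x) =
        fun k : ℕ => ∏ i, ∫ x in Set.Icc (0 : ℝ) 1, φ i x * (x : ℂ) ^ k := by
      funext k
      rw [restrict_cube]
      exact integral_fintype_prod_eq_prod (𝕜 := ℂ) fun i x => φ i x * (x : ℂ) ^ k
    rwa [h3] at h1

lemma integral_Icc_poly_mul_pow (n : ℕ) (a : ℕ → ℂ) (k : ℕ) :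
    ∫ x in Set.Icc (0 : ℝ) 1, poly n a x * (x : ℂ) ^ k =
      ∑ r ∈ range (n + 1), a r * (1 / ((k : ℂ) + 1 + r)) := by
  have h1 : ∀ x : ℝ, poly n a x * (x : ℂ) ^ k =
      ∑ r ∈ range (n + 1), a r * ((x ^ (k + r) : ℝ) : ℂ) := fun x => by
    rw [poly, sum_mul]
    refine sum_congr rfl fun r _ => ?_
    push_cast
    ring
  simp only [h1]
  rw [integral_finsetSum _ fun r _ => Continuous.integrableOn_Icc (by fun_prop)]
  refine sum_congr rfl fun r _ => ?_
  rw [integral_const_mul, integral_complex_ofReal, integral_Icc_pow]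
  push_cast
  ring

/-- Each of the `t` coordinates carrying no polynomial integrates to `1 / (k + 1)`, whence the power
`t`; the other three give the shifted simple poles. -/
lemma integrand_and_hasSum (n : ℕ) (a b c : ℕ → ℂ) (t : ℕ) :
    IntegrableOn (integrand n a b c (t + 3) (by omega)) (Set.Icc (0 : Fin (t + 3) → ℝ) 1) ∧
      HasSum (fun k : ℕ => ∑ i ∈ range (n + 1), ∑ j ∈ range (n + 1), ∑ l ∈ range (n + 1),
          a i * b j * c l * (1 / (((k : ℂ) + 1 + i) * ((k : ℂ) + 1 + j) * ((k : ℂ) + 1 + l)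
            * ((k : ℂ) + 1) ^ t)))
        (I n a b c (t + 3) (by omega)) := by
  set φ : Fin (t + 3) → ℝ → ℂ := Fin.cons (fun x => poly n a x) (Fin.cons (fun x => poly n b x)
    (Fin.cons (fun x => poly n c x) fun _ _ => 1)) with hφ
  have hpoly : ∀ a, Continuous fun x : ℝ => poly n a x := fun a => by
    unfold poly
    fun_prop
  have hcont : ∀ i, Continuous (φ i) := by
    refine Fin.cases (hpoly a) (Fin.cases (hpoly b) (Fin.cases (hpoly c) fun i => ?_))
    exact continuous_const
  have hint : integrand n a b c (t + 3) (by omega) =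
      fun x : Fin (t + 3) → ℝ => (∏ i, φ i (x i)) / (1 - ∏ i, (x i : ℂ)) := by
    funext x
    have h : ∏ i, φ i (x i) = poly n a (x 0) * (poly n b (x 1) * poly n c (x 2)) := by
      rw [Fin.prod_univ_succ, Fin.prod_univ_succ, Fin.prod_univ_succ]
      simp only [hφ, Fin.cons_zero, Fin.cons_succ, prod_const_one, mul_one]
      rfl
    rw [h, integrand, mul_assoc]
    rfl
  obtain ⟨h1, h2⟩ := geometric_kernel (by omega) φ hcont
  rw [← hint] at h1
  refine ⟨h1, ?_⟩
  rw [I, hint]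
  convert h2 using 2 with k
  rw [Fin.prod_univ_succ, Fin.prod_univ_succ, Fin.prod_univ_succ]
  simp only [hφ, Fin.cons_zero, Fin.cons_succ, integral_Icc_poly_mul_pow, one_mul, prod_const,
    card_univ, Fintype.card_fin]
  have h3 : ∫ x in Set.Icc (0 : ℝ) 1, (x : ℂ) ^ k = 1 / ((k : ℂ) + 1) := by
    have := integral_Icc_pow k
    rw [← Complex.ofReal_inj, ← integral_complex_ofReal] at this
    push_cast at this
    exact this
  rw [h3]
  rw [sum_mul]
  refine sum_congr rfl fun i _ => ?_
  rw [sum_mul, mul_sum]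
  refine sum_congr rfl fun j _ => ?_
  rw [sum_mul, mul_sum, mul_sum]
  refine sum_congr rfl fun l _ => ?_
  simp only [one_div, mul_inv, inv_pow]
  ring

/-! ### Grouping index sums by coincidences -/

lemma sum_range_sq {M : Type*} [AddCommMonoid M] (g : ℕ → ℕ → M) (N : ℕ) :
    ∑ i ∈ range N, ∑ j ∈ range N, g i j =
      ∑ r ∈ range N, g r r + ∑ r ∈ range N, ∑ l ∈ range r, (g r l + g l r) := by
  induction N with
  | zero => simp
  | succ N ih =>
    simp only [sum_range_succ _ N, sum_add_distrib, ih]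
    abel

/-- Grouping of a triple sum over a cube of indices into its diagonal, the pairs `l < r` and the
triples `i < l < r`. -/
lemma sum_range_cube {M : Type*} [AddCommMonoid M] (g : ℕ → ℕ → ℕ → M) (N : ℕ) :
    ∑ i ∈ range N, ∑ j ∈ range N, ∑ k ∈ range N, g i j k =
      ∑ r ∈ range N, g r r r +
      ∑ r ∈ range N, ∑ l ∈ range r,
        ((g r r l + g r l r + g l r r) + (g l l r + g l r l + g r l l)) +
      ∑ r ∈ range N, ∑ l ∈ range r, ∑ i ∈ range l,
        (g i r l + g r l i + g l i r + (g i l r + g l r i + g r i l)) := by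
  induction N with
  | zero => simp
  | succ N ih =>
    have h1 := sum_range_sq (fun i j => g N i j) N
    have h2 := sum_range_sq (fun i j => g i N j) N
    have h3 := sum_range_sq (fun i j => g i j N) N
    simp only [sum_range_succ _ N, sum_add_distrib] at *
    rw [ih, h1, h2, h3]
    abel

lemma sum_Icc_one_eq_range {M : Type*} [AddCommMonoid M] (g : ℕ → M) (n : ℕ) (h : g 0 = 0) :
    ∑ r ∈ Icc 1 n, g r = ∑ r ∈ range (n + 1), g r := by
  rw [range_eq_Ico, sum_eq_sum_Ico_succ_bot (Nat.succ_pos n), h, zero_add]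
  rfl

lemma sum_Icc_two_eq_range {M : Type*} [AddCommMonoid M] (g : ℕ → M) (n : ℕ) (h : g 0 = 0)
    (h' : g 1 = 0) : ∑ r ∈ Icc 2 n, g r = ∑ r ∈ range (n + 1), g r := by
  rw [← sum_Icc_one_eq_range g n h]
  refine sum_subset (Icc_subset_Icc_left one_le_two) fun r hr hr' => ?_
  simp only [mem_Icc] at hr hr'
  obtain rfl : r = 1 := by omega
  exact h'

lemma sum_Icc_pred_eq_range {M : Type*} [AddCommMonoid M] (g : ℕ → M) (r : ℕ) (h : g 0 = 0) :
    ∑ l ∈ Icc 1 (r - 1), g l = ∑ l ∈ range r, g l := by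
  rcases r with _ | r
  · simp
  · exact sum_Icc_one_eq_range g r h

/-- The lower limits 2 and 1 in the definition discard only empty inner sums. -/
lemma tripleSum_eq_range (n : ℕ) (a b c w : ℕ → ℂ) :
    tripleSum n a b c w = ∑ r ∈ range (n + 1), ∑ l ∈ range r, ∑ i ∈ range l,
      (S a b c i r l + S a b c i l r) *
        (w i / (((i : ℂ) - r) * ((i : ℂ) - l)) + w r / (((r : ℂ) - i) * ((r : ℂ) - l)) +
          w l / (((l : ℂ) - i) * ((l : ℂ) - r))) := by
  rw [tripleSum, sum_Icc_two_eq_range _ _ (by simp) (by simp)]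
  exact sum_congr rfl fun r _ => sum_Icc_pred_eq_range _ _ (by simp)

/-- The grouped triple sum for a symmetric function. -/
lemma sum_range_cube_symmetric (N : ℕ) (a b c : ℕ → ℂ) (f : ℕ → ℕ → ℕ → ℂ)
    (h12 : ∀ i j k, f i j k = f j i k) (h23 : ∀ i j k, f i j k = f i k j) :
    ∑ i ∈ range N, ∑ j ∈ range N, ∑ k ∈ range N, a i * b j * c k * f i j k =
      ∑ r ∈ range N, a r * b r * c r * f r r r +
      ∑ r ∈ range N, ∑ l ∈ range r, (S a b c r r l * f r r l + S a b c l l r * f l l r) +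
      ∑ r ∈ range N, ∑ l ∈ range r, ∑ i ∈ range l,
        (S a b c i r l + S a b c i l r) * f i l r := by
  rw [sum_range_cube]
  congr 1
  · congr 1
    refine sum_congr rfl fun r _ => sum_congr rfl fun l _ => ?_
    rw [h23 r l r, h12 l r r, h23 r l r, h23 l r l, h12 r l l, h23 l r l]
    simp only [S]
    ring
  · refine sum_congr rfl fun r _ => sum_congr rfl fun l _ => sum_congr rfl fun i _ => ?_
    rw [h23 i r l, h12 r l i, h23 l r i, h12 l i r, h12 r i l, h23 i r l]
    simp only [S]
    ring

/-! ### Partial fractions in the shifts -/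

/-- The linear combination of diagonal, double and triple sums to which the integral reduces. -/
noncomputable def combination (n : ℕ) (a b c E D F : ℕ → ℂ) : ℂ :=
  ∑ r ∈ range (n + 1), a r * b r * c r * F r +
  ∑ r ∈ range (n + 1), ∑ l ∈ range r,
    ((S a b c r r l - S a b c l l r) * ((E l - E r) / ((r : ℂ) - l) ^ 2)
      - (S a b c r r l * D r - S a b c l l r * D l) / ((r : ℂ) - l)) +
  tripleSum n a b c E

lemma natCast_sub_ne_zero {r l : ℕ} (h : l ≠ r) : (r : ℂ) - l ≠ 0 :=
  sub_ne_zero.2 fun h' => h (Nat.cast_injective h'.symm)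

/-- Partial fractions: `x + r`, `x + l`, `x + i` with distinct shifts. -/
lemma combination_partial_fractions (n : ℕ) (a b c : ℕ → ℂ) (x y κ : ℂ)
    (hx : ∀ r : ℕ, x + r ≠ 0) :
    ∑ i ∈ range (n + 1), ∑ j ∈ range (n + 1), ∑ k ∈ range (n + 1),
      a i * b j * c k * (1 / ((x + i) * (x + j) * (x + k) * y)) =
    combination n a b c (fun i => 1 / ((x + i) * y) - κ) (fun i => 1 / ((x + i) ^ 2 * y))
      (fun i => 1 / ((x + i) ^ 3 * y)) := by
  rw [sum_range_cube_symmetric _ _ _ _ (fun i j k => 1 / ((x + i) * (x + j) * (x + k) * y))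
    (fun i j k => by ring_nf) (fun i j k => by ring_nf), combination, tripleSum_eq_range]
  simp only [← div_div _ _ y]
  congr 1
  · congr 1
    · refine sum_congr rfl fun r _ => ?_
      ring_nf
    · refine sum_congr rfl fun r _ => sum_congr rfl fun l hl => ?_
      have h1 := hx r
      have h2 := hx l
      have h3 := natCast_sub_ne_zero (mem_range.1 hl).ne
      generalize S a b c r r l = A
      generalize S a b c l l r = B
      have e1 : 1 / ((x + r) * (x + r) * (x + l)) =
        (1 / (x + l) - 1 / (x + r)) / ((r : ℂ) - l) ^ 2 - 1 / (x + r) ^ 2 / ((r : ℂ) - l) := by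
        field_simp
        ring
      have e2 : 1 / ((x + l) * (x + l) * (x + r)) =
        1 / (x + l) ^ 2 / ((r : ℂ) - l) - (1 / (x + l) - 1 / (x + r)) / ((r : ℂ) - l) ^ 2 := by
        field_simp
        ring
      rw [e1, e2]
      ring
  · refine sum_congr rfl fun r _ => sum_congr rfl fun l hl => sum_congr rfl fun i hi => ?_
    congr 1
    have h1 := hx r
    have h2 := hx l
    have h3 := hx i
    rw [mem_range] at hi hl
    have h4 := natCast_sub_ne_zero hl.ne
    have h5 := natCast_sub_ne_zero hi.ne
    have h6 := natCast_sub_ne_zero (hi.trans hl).ne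
    have h4' := natCast_sub_ne_zero hl.ne'
    have h5' := natCast_sub_ne_zero hi.ne'
    have h6' := natCast_sub_ne_zero (hi.trans hl).ne'
    -- The residues of `1/((x+i)(x+l)(x+r))` sum to zero, so `κ` drops out here; in the double sums
    -- it cancels in the difference `E l - E r`.
    have e1 : 1 / (((i : ℂ) - r) * ((i : ℂ) - l)) + 1 / (((r : ℂ) - i) * ((r : ℂ) - l))
        + 1 / (((l : ℂ) - i) * ((l : ℂ) - r)) = 0 := by
      rw [← neg_sub (r : ℂ) i, ← neg_sub (l : ℂ) i, ← neg_sub (r : ℂ) l]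
      field_simp
      ring
    have e2 : 1 / ((x + i) * (x + l) * (x + r)) =
        1 / (x + i) / (((i : ℂ) - r) * ((i : ℂ) - l)) +
        1 / (x + r) / (((r : ℂ) - i) * ((r : ℂ) - l))
        + 1 / (x + l) / (((l : ℂ) - i) * ((l : ℂ) - r)) := by
      rw [← neg_sub (r : ℂ) i, ← neg_sub (l : ℂ) i, ← neg_sub (r : ℂ) l]
      field_simp
      ring
    rw [e2]
    linear_combination κ * e1

lemma hasSum_combination (n : ℕ) (a b c : ℕ → ℂ) {e d f : ℕ → ℕ → ℂ} {E D F : ℕ → ℂ}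
    (hE : ∀ i, HasSum (fun k => e k i) (E i)) (hD : ∀ i, HasSum (fun k => d k i) (D i))
    (hF : ∀ i, HasSum (fun k => f k i) (F i)) :
    HasSum (fun k => combination n a b c (e k) (d k) (f k)) (combination n a b c E D F) := by
  simp only [combination, tripleSum_eq_range]
  refine ((hasSum_sum fun r _ => (hF r).mul_left _).add (hasSum_sum fun r _ =>
    hasSum_sum fun l _ => ?_)).add (hasSum_sum fun r _ => hasSum_sum fun l _ =>
      hasSum_sum fun i _ => ?_)
  · exact ((((hE l).sub (hE r)).div_const _).mul_left _).sub
      ((((hD r).mul_left _).sub ((hD l).mul_left _)).div_const _)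
  · exact ((((hE i).div_const _).add ((hE r).div_const _)).add ((hE l).div_const _)).mul_left _

/-- The integral as a combination of one-parameter series, with a common regularization `κ`
of the series attached to simple poles. -/
lemma I_eq_combination (n : ℕ) (a b c : ℕ → ℂ) (t : ℕ) (κ E D F : ℕ → ℂ)
    (hE : ∀ i : ℕ, HasSum (fun k : ℕ => 1 / (((k : ℂ) + 1 + i) * ((k : ℂ) + 1) ^ t) - κ k) (E i))
    (hD : ∀ i : ℕ, HasSum (fun k : ℕ => 1 / (((k : ℂ) + 1 + i) ^ 2 * ((k : ℂ) + 1) ^ t)) (D i))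
    (hF : ∀ i : ℕ, HasSum (fun k : ℕ => 1 / (((k : ℂ) + 1 + i) ^ 3 * ((k : ℂ) + 1) ^ t)) (F i)) :
    I n a b c (t + 3) (by omega) = combination n a b c E D F := by
  refine (integrand_and_hasSum n a b c t).2.unique ?_
  convert hasSum_combination n a b c hE hD hF using 2 with k
  exact combination_partial_fractions n a b c _ _ (κ k) fun r => by
    exact_mod_cast (by omega : k + 1 + r ≠ 0)

/-! ### Closed forms of the one-parameter series -/

lemma hasSum_of_eq {f g : ℕ → ℂ} {x : ℂ} (h : ∀ k, f k = g k) (hf : HasSum f x) : HasSum g x :=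
  funext h ▸ hf

lemma hasSum_riemannZeta {p : ℕ} (hp : 2 ≤ p) :
    HasSum (fun k : ℕ => 1 / ((k : ℂ) + 1) ^ p) (riemannZeta p) := by
  have h1 : Summable fun k : ℕ => 1 / (k : ℂ) ^ p := by
    have := Complex.ofRealCLM.summable (Real.summable_one_div_nat_pow.2 (by omega : 1 < p))
    simpa using this
  -- The omitted term is `1 / 0 ^ p`, which is `0` by convention.
  have h2 := (hasSum_nat_add_iff' 1).2 h1.hasSum
  rw [← zeta_nat_eq_tsum_of_gt_one (by omega)] at h2
  simpa [show p ≠ 0 by omega] using h2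

lemma H_eq_sum_range (m r : ℕ) : H m r = ∑ k ∈ range r, 1 / ((k : ℂ) + 1) ^ m := by
  rw [H, range_eq_Ico]
  have := sum_Ico_add' (fun k : ℕ => 1 / (k : ℂ) ^ m) 0 r 1
  push_cast at this
  rw [this]
  rfl

@[simp] lemma H_zero (m : ℕ) : H m 0 = 0 := by simp [H]

lemma hasSum_shift {p : ℕ} {z : ℂ} (hz : HasSum (fun k : ℕ => 1 / ((k : ℂ) + 1) ^ p) z) (r : ℕ) :
    HasSum (fun k : ℕ => 1 / ((k : ℂ) + 1 + r) ^ p) (z - H p r) := by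
  have := (hasSum_nat_add_iff' r).2 hz
  rw [H_eq_sum_range]
  refine hasSum_of_eq (fun k => ?_) this
  push_cast
  ring

lemma hasSum_telescoping (r : ℕ) :
    HasSum (fun k : ℕ => 1 / ((k : ℂ) + 1 + r) - 1 / ((k : ℂ) + 1 + (r + 1 : ℕ)))
      (1 / ((r : ℂ) + 1)) := by
  -- Over the reals the terms are nonnegative, so convergence of the partial sums already gives
  -- `HasSum`.
  have h1 : HasSum (fun k : ℕ => 1 / ((k : ℝ) + 1 + r) - 1 / ((k : ℝ) + 1 + (r + 1 : ℕ)))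
      (1 / ((r : ℝ) + 1)) := by
    rw [hasSum_iff_tendsto_nat_of_nonneg]
    · have h2 : ∀ N : ℕ, ∑ k ∈ range N, (1 / ((k : ℝ) + 1 + r) - 1 / ((k : ℝ) + 1 + (r + 1 : ℕ))) =
          1 / ((r : ℝ) + 1) - 1 / ((N : ℝ) + (1 + r)) := fun N => by
        have := sum_range_sub' (fun k : ℕ => 1 / ((k : ℝ) + 1 + r)) N
        calc _ = ∑ k ∈ range N, (1 / ((k : ℝ) + 1 + r) - 1 / (((k + 1 : ℕ) : ℝ) + 1 + r)) :=
              sum_congr rfl fun k _ => by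
                push_cast
                ring
          _ = _ := by
            rw [this]
            push_cast
            ring
      simp only [h2]
      have h3 : Filter.Tendsto (fun N : ℕ => 1 / ((N : ℝ) + (1 + r))) Filter.atTop (nhds 0) := by
        simp only [one_div]
        exact (Filter.tendsto_atTop_add_const_right _ _
          tendsto_natCast_atTop_atTop).inv_tendsto_atTop
      simpa using h3.const_sub (1 / ((r : ℝ) + 1))
    · intro k
      rw [sub_nonneg]
      refine one_div_le_one_div_of_le (by positivity) ?_
      push_cast
      linarith
  have h2 := Complex.hasSum_ofReal.2 h1
  push_cast at h2 ⊢
  exact h2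

lemma hasSum_harmonic (r : ℕ) :
    HasSum (fun k : ℕ => 1 / ((k : ℂ) + 1 + r) - 1 / ((k : ℂ) + 1)) (-H 1 r) := by
  induction r with
  | zero => simp
  | succ r ih =>
    have := ih.sub (hasSum_telescoping r)
    rw [H_eq_sum_range] at this ⊢
    rw [sum_range_succ]
    rw [show -(∑ k ∈ range r, 1 / ((k : ℂ) + 1) ^ 1 + 1 / ((r : ℂ) + 1) ^ 1) =
      -∑ k ∈ range r, 1 / ((k : ℂ) + 1) ^ 1 - 1 / ((r : ℂ) + 1) by ring]
    refine hasSum_of_eq (fun k => ?_) this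
    ring

/-- With `X = x + r`, dividing `X - x = r` by `r X^(p+1) x^(t+1)` expresses the term through two
with one exponent lowered. -/
lemma hasSum_partial_fractions {p t r : ℕ} (hr : r ≠ 0) {x y : ℂ}
    (hx : HasSum (fun k : ℕ => 1 / (((k : ℂ) + 1 + r) ^ p * ((k : ℂ) + 1) ^ (t + 1))) x)
    (hy : HasSum (fun k : ℕ => 1 / (((k : ℂ) + 1 + r) ^ (p + 1) * ((k : ℂ) + 1) ^ t)) y) :
    HasSum (fun k : ℕ => 1 / (((k : ℂ) + 1 + r) ^ (p + 1) * ((k : ℂ) + 1) ^ (t + 1)))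
      ((x - y) / r) := by
  refine hasSum_of_eq (fun k => ?_) ((hx.sub hy).div_const (r : ℂ))
  have h1 : (k : ℂ) + 1 + r ≠ 0 := by exact_mod_cast (by omega : k + 1 + r ≠ 0)
  have h2 : (k : ℂ) + 1 ≠ 0 := by exact_mod_cast (by omega : k + 1 ≠ 0)
  have h3 : (r : ℂ) ≠ 0 := by exact_mod_cast hr
  field_simp
  ring

/-- Closed form of `∑ 1 / ((k + r) k ^ (u + 1))`, with `z p` in place of `ζ(p)`. -/
noncomputable def simpleSeries (z : ℕ → ℂ) (u r : ℕ) : ℂ :=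
  (if r = 0 then z (u + 2) else 0) +
    (∑ j ∈ range u, (-1) ^ j * z (u + 1 - j) * weight (fun _ => 1) (j + 1) r +
      (-1) ^ u * weight (H 1) (u + 1) r)

/-- Closed form of `∑ 1 / ((k + r) ^ 2 k ^ (u + 1))`, with `z p` in place of `ζ(p)`. -/
noncomputable def doubleSeries (z : ℕ → ℂ) (u r : ℕ) : ℂ :=
  (if r = 0 then z (u + 3) else 0) +
    (∑ j ∈ range u, (-1) ^ j * z (u + 1 - j) * (((j : ℂ) + 1) * weight (fun _ => 1) (j + 2) r) +
      (-1) ^ u * (((u : ℂ) + 1) * weight (H 1) (u + 2) r + weight (H 2) (u + 1) r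
        - z 2 * weight (fun _ => 1) (u + 1) r))

/-- Closed form of `∑ 1 / ((k + r) ^ 3 k ^ (u + 1))`, with `z p` in place of `ζ(p)`. -/
noncomputable def tripleSeries (z : ℕ → ℂ) (u r : ℕ) : ℂ :=
  (if r = 0 then z (u + 4) else 0) +
    (∑ j ∈ range u, (-1) ^ j * z (u + 1 - j) *
        (((j : ℂ) + 1) * ((j : ℂ) + 2) / 2 * weight (fun _ => 1) (j + 3) r) +
      (-1) ^ u * (((u : ℂ) + 1) * ((u : ℂ) + 2) / 2 * weight (H 1) (u + 3) r
        + ((u : ℂ) + 1) * weight (H 2) (u + 2) r + weight (H 3) (u + 1) r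
        - z 2 * (((u : ℂ) + 1) * weight (fun _ => 1) (u + 2) r)
        - z 3 * weight (fun _ => 1) (u + 1) r))

variable {z : ℕ → ℂ}

/-- For `r ≠ 0` the recursion is `E_(u+1) = (ζ(u+2) - E_u) / r`, started from the regularized
harmonic series. -/
lemma hasSum_simpleSeries (hz : ∀ p, 2 ≤ p → HasSum (fun k : ℕ => 1 / ((k : ℂ) + 1) ^ p) (z p))
    (u r : ℕ) :
    HasSum (fun k : ℕ => 1 / (((k : ℂ) + 1 + r) * ((k : ℂ) + 1) ^ (u + 1)))
      (simpleSeries z u r) := by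
  rcases eq_or_ne r 0 with rfl | hr
  · simpa [simpleSeries, weight, ← pow_succ'] using hz (u + 2) (by omega)
  have h3 : (r : ℂ) ≠ 0 := by exact_mod_cast hr
  induction u with
  | zero =>
    rw [show simpleSeries z 0 r = -H 1 r / (-r : ℂ) by simp [simpleSeries, weight, hr]]
    refine hasSum_of_eq (fun k => ?_) ((hasSum_harmonic r).div_const (-r : ℂ))
    have h1 : (k : ℂ) + 1 + r ≠ 0 := by exact_mod_cast (by omega : k + 1 + r ≠ 0)
    have h2 : (k : ℂ) + 1 ≠ 0 := by exact_mod_cast (by omega : k + 1 ≠ 0)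
    field_simp
    ring
  | succ u ih =>
    have h := hasSum_partial_fractions (p := 0) (t := u + 1) hr
      (by simpa using hz (u + 2) (by omega)) (by simpa using ih)
    simp only [zero_add, pow_one] at h
    convert h using 1
    -- The split-off term `j = 0` is the new `ζ(u+2)`; the shifted remainder is the old sum divided
    -- by `-r`.
    simp only [simpleSeries, weight, hr, if_false, sum_range_succ' _ u, Nat.add_sub_add_right,
      Nat.sub_zero]
    have h4 : ∀ j ∈ range u, (-1) ^ (j + 1) * z (u + 1 - j) * (1 / (r : ℂ) ^ (j + 1 + 1)) =
        -((-1) ^ j * z (u + 1 - j) * (1 / (r : ℂ) ^ (j + 1)) / r) := fun j _ => by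
      field_simp
      ring
    rw [sum_congr rfl h4, sum_neg_distrib, ← sum_div]
    generalize Finset.sum (range u) (_ : ℕ → ℂ) = X
    field_simp
    ring

/-- For `r ≠ 0` the recursion is `D_u = (E_u - D_(u-1)) / r`, where `D_(-1)` is the shifted series
`ζ(2) - H 2 r`; this start is the source of the separate `z 2` term. -/
lemma hasSum_doubleSeries (hz : ∀ p, 2 ≤ p → HasSum (fun k : ℕ => 1 / ((k : ℂ) + 1) ^ p) (z p))
    (u r : ℕ) :
    HasSum (fun k : ℕ => 1 / (((k : ℂ) + 1 + r) ^ 2 * ((k : ℂ) + 1) ^ (u + 1)))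
      (doubleSeries z u r) := by
  rcases eq_or_ne r 0 with rfl | hr
  · simpa [doubleSeries, weight, ← pow_add, add_comm 2] using hz (u + 3) (by omega)
  have h3 : (r : ℂ) ≠ 0 := by exact_mod_cast hr
  induction u with
  | zero =>
    convert hasSum_partial_fractions (p := 1) (t := 0) hr
      (by simpa using hasSum_simpleSeries hz 0 r)
      (by simpa using hasSum_shift (hz 2 le_rfl) r) using 1
    simp [simpleSeries, doubleSeries, weight, hr]
    field_simp
    ring
  | succ u ih =>
    convert hasSum_partial_fractions (p := 1) (t := u + 1) hr
      (by simpa using hasSum_simpleSeries hz (u + 1) r) ih using 1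
    simp only [simpleSeries, doubleSeries, weight, hr, if_false, sum_range_succ' _ u,
      Nat.add_sub_add_right, Nat.sub_zero]
    have h4 : ∀ j ∈ range u, (-1) ^ (j + 1) * z (u + 1 - j) *
          (((j + 1 : ℕ) + 1 : ℂ) * (1 / (r : ℂ) ^ (j + 1 + 2))) =
        (-1) ^ (j + 1) * z (u + 1 - j) * (1 / (r : ℂ) ^ (j + 1 + 1)) / r
        - (-1) ^ j * z (u + 1 - j) * (((j : ℂ) + 1) * (1 / (r : ℂ) ^ (j + 2))) / r := fun j _ => by
      push_cast
      field_simp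
      ring
    rw [sum_congr rfl h4, sum_sub_distrib, ← sum_div, ← sum_div]
    generalize Finset.sum (range u) (_ : ℕ → ℂ) = X
    generalize Finset.sum (range u) (_ : ℕ → ℂ) = Y
    push_cast
    field_simp
    ring

/-- The same recursion one order higher, fed by the double series and started from `ζ(3) - H 3 r`.
-/
lemma hasSum_tripleSeries (hz : ∀ p, 2 ≤ p → HasSum (fun k : ℕ => 1 / ((k : ℂ) + 1) ^ p) (z p))
    (u r : ℕ) :
    HasSum (fun k : ℕ => 1 / (((k : ℂ) + 1 + r) ^ 3 * ((k : ℂ) + 1) ^ (u + 1)))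
      (tripleSeries z u r) := by
  rcases eq_or_ne r 0 with rfl | hr
  · simpa [tripleSeries, weight, ← pow_add, add_comm 3] using hz (u + 4) (by omega)
  have h3 : (r : ℂ) ≠ 0 := by exact_mod_cast hr
  induction u with
  | zero =>
    convert hasSum_partial_fractions (p := 2) (t := 0) hr
      (by simpa using hasSum_doubleSeries hz 0 r)
      (by simpa using hasSum_shift (hz 3 (by norm_num)) r) using 1
    simp [tripleSeries, doubleSeries, weight, hr]
    field_simp
    ring
  | succ u ih =>
    convert hasSum_partial_fractions (p := 2) (t := u + 1) hr
      (hasSum_doubleSeries hz (u + 1) r) ih using 1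
    simp only [tripleSeries, doubleSeries, weight, hr, if_false, sum_range_succ' _ u,
      Nat.add_sub_add_right, Nat.sub_zero]
    have h4 : ∀ j ∈ range u, (-1) ^ (j + 1) * z (u + 1 - j) *
          (((j + 1 : ℕ) + 1 : ℂ) * ((j + 1 : ℕ) + 2 : ℂ) / 2 * (1 / (r : ℂ) ^ (j + 1 + 3))) =
        (-1) ^ (j + 1) * z (u + 1 - j) *
          (((j + 1 : ℕ) + 1 : ℂ) * (1 / (r : ℂ) ^ (j + 1 + 2))) / r
        - (-1) ^ j * z (u + 1 - j) * (((j : ℂ) + 1) * ((j : ℂ) + 2) / 2 *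
          (1 / (r : ℂ) ^ (j + 3))) / r := fun j _ => by
      push_cast
      field_simp
      ring
    rw [sum_congr rfl h4, sum_sub_distrib, ← sum_div, ← sum_div]
    generalize Finset.sum (range u) (_ : ℕ → ℂ) = X
    generalize Finset.sum (range u) (_ : ℕ → ℂ) = Y
    push_cast
    field_simp
    ring

/-! ### Linearity of `combination` -/

variable (n : ℕ) (a b c : ℕ → ℂ)

lemma tripleSum_add (w w' : ℕ → ℂ) :
    tripleSum n a b c (fun i => w i + w' i) = tripleSum n a b c w + tripleSum n a b c w' := by
  simp only [tripleSum, ← sum_add_distrib]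
  refine sum_congr rfl fun r _ => sum_congr rfl fun l _ => sum_congr rfl fun i _ => ?_
  ring

lemma tripleSum_smul (x : ℂ) (w : ℕ → ℂ) :
    tripleSum n a b c (fun i => x * w i) = x * tripleSum n a b c w := by
  simp only [tripleSum, mul_sum]
  refine sum_congr rfl fun r _ => sum_congr rfl fun l _ => sum_congr rfl fun i _ => ?_
  ring

lemma tripleSum_zero : tripleSum n a b c (fun _ => 0) = 0 := by
  simp [tripleSum]

lemma combination_add (E D F E' D' F' : ℕ → ℂ) :
    combination n a b c (fun i => E i + E' i) (fun i => D i + D' i) (fun i => F i + F' i) =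
      combination n a b c E D F + combination n a b c E' D' F' := by
  simp only [combination, tripleSum_add]
  have h1 : ∀ u v w u' v' w' : ℂ, u + v + w + (u' + v' + w') =
    (u + u') + (v + v') + (w + w') := by intros; ring
  rw [h1]
  simp only [← sum_add_distrib]
  congr 1
  refine sum_congr rfl fun r _ => ?_
  congr 1
  · ring
  · refine sum_congr rfl fun l _ => ?_
    ring

lemma combination_smul (x : ℂ) (E D F : ℕ → ℂ) :
    combination n a b c (fun i => x * E i) (fun i => x * D i) (fun i => x * F i) =
      x * combination n a b c E D F := by
  simp only [combination, tripleSum_smul, mul_add, mul_sum]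
  congr 2
  · refine sum_congr rfl fun r _ => ?_
    ring
  · refine sum_congr rfl fun r _ => sum_congr rfl fun l _ => ?_
    ring

lemma combination_sum (x : ℕ → ℂ) (E D F : ℕ → ℕ → ℂ) (u : ℕ) :
    combination n a b c (fun i => ∑ j ∈ range u, x j * E j i)
        (fun i => ∑ j ∈ range u, x j * D j i) (fun i => ∑ j ∈ range u, x j * F j i) =
      ∑ j ∈ range u, x j * combination n a b c (E j) (D j) (F j) := by
  induction u with
  | zero => simp [combination, tripleSum]
  | succ u ih =>
    simp only [sum_range_succ]
    rw [combination_add, ih, combination_smul]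

/-! ### Values of `combination` on the building blocks -/

/-- Index 0 is special because its pole merges with the powers of `x` from the remaining
coordinates, so the pairs with `l = 0` are kept apart. -/
lemma sum_range_pairs {M : Type*} [AddCommMonoid M] (g : ℕ → ℕ → M) :
    ∑ r ∈ range (n + 1), ∑ l ∈ range r, g r l =
      ∑ r ∈ Icc 1 n, g r 0 + ∑ r ∈ Icc 2 n, ∑ l ∈ Icc 1 (r - 1), g r l := by
  rw [← sum_Icc_one_eq_range _ _ (by simp)]
  have h1 : ∑ r ∈ Icc 2 n, ∑ l ∈ Icc 1 (r - 1), g r l =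
      ∑ r ∈ Icc 1 n, ∑ l ∈ Icc 1 (r - 1), g r l := by
    rw [sum_Icc_two_eq_range _ _ (by simp) (by simp), sum_Icc_one_eq_range _ _ (by simp)]
  rw [h1, ← sum_add_distrib]
  refine sum_congr rfl fun r hr => ?_
  obtain ⟨r, rfl⟩ := Nat.exists_eq_succ_of_ne_zero (by have := (mem_Icc.1 hr).1; omega : r ≠ 0)
  rw [range_eq_Ico, sum_eq_sum_Ico_succ_bot (Nat.succ_pos r)]
  rfl

lemma S_comm (μ ν l : ℕ) : S a b c μ ν l = S a b c ν l μ := by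
  simp only [S]
  ring

/-- The contribution of functions supported at `0`. -/
lemma combination_indicator (x y w : ℂ) :
    combination n a b c (fun r => if r = 0 then x else 0) (fun r => if r = 0 then y else 0)
      (fun r => if r = 0 then w else 0) =
    w * (a 0 * b 0 * c 0) + y * ∑ r ∈ Icc 1 n, S a b c 0 0 r / (r : ℂ) + x * second n a b c := by
  have h1 : tripleSum n a b c (fun r => if r = 0 then x else 0) =
      -x * ∑ r ∈ Icc 2 n, ∑ l ∈ Icc 1 (r - 1),
      (S a b c 0 l r + S a b c 0 r l) / ((r : ℂ) - l) * (1 / (r : ℂ) - 1 / (l : ℂ)) := by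
    simp only [tripleSum, mul_sum]
    refine sum_congr rfl fun r hr => sum_congr rfl fun l hl => ?_
    simp only [mem_Icc] at hr hl
    obtain ⟨m, rfl⟩ : ∃ m, l = m + 1 := ⟨l - 1, by omega⟩
    -- As `l` and `r` are positive, only `i = 0` survives, contributing `x / (r l)`.
    rw [sum_range_succ', sum_eq_zero, zero_add]
    · have h1 : (r : ℂ) ≠ 0 := by exact_mod_cast (by omega : r ≠ 0)
      have h2 : ((m + 1 : ℕ) : ℂ) ≠ 0 := by exact_mod_cast (by omega : m + 1 ≠ 0)
      have h3 : (r : ℂ) - (m + 1 : ℕ) ≠ 0 := natCast_sub_ne_zero (by omega)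
      rw [if_neg (by omega : r ≠ 0)]
      generalize ((m + 1 : ℕ) : ℂ) = L at *
      simp
      field_simp
      ring
    · intro i _
      simp [show r ≠ 0 by omega]
  rw [combination, h1, sum_range_pairs, second, sum_range_succ']
  simp only [Nat.cast_zero, if_true, sub_zero]
  have h2 : ∑ r ∈ range n, a (r + 1) * b (r + 1) * c (r + 1) *
      (if r + 1 = 0 then w else 0) = 0 := sum_eq_zero fun r _ => by simp
  have h3 : ∑ r ∈ Icc 2 n, ∑ l ∈ Icc 1 (r - 1),
      ((S a b c r r l - S a b c l l r) *
          (((if l = 0 then x else 0) - if r = 0 then x else 0) / ((r : ℂ) - l) ^ 2)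
        - ((S a b c r r l * if r = 0 then y else 0) - S a b c l l r * if l = 0 then y else 0)
          / ((r : ℂ) - l)) = 0 :=
    sum_eq_zero fun r hr => sum_eq_zero fun l hl => by
      simp only [mem_Icc] at hr hl
      simp [show r ≠ 0 by omega, show l ≠ 0 by omega]
  have h4 : ∑ r ∈ Icc 1 n, ((S a b c r r 0 - S a b c 0 0 r) *
        ((x - if r = 0 then x else 0) / (r : ℂ) ^ 2)
        - ((S a b c r r 0 * if r = 0 then y else 0) - S a b c 0 0 r * y) / (r : ℂ)) =
      y * ∑ r ∈ Icc 1 n, S a b c 0 0 r / (r : ℂ) +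
      x * ∑ r ∈ Icc 1 n, (S a b c 0 r r - S a b c 0 0 r) / (r : ℂ) ^ 2 := by
    rw [mul_sum, mul_sum, ← sum_add_distrib]
    refine sum_congr rfl fun r hr => ?_
    simp only [mem_Icc] at hr
    rw [S_comm _ _ _ 0 r r]
    simp [show r ≠ 0 by omega]
    ring
  rw [h2, h3, h4]
  ring

/-- The contribution of functions vanishing at `0`. -/
lemma combination_of_vanishing {E D F : ℕ → ℂ} (hE : E 0 = 0) (hD : D 0 = 0) (hF : F 0 = 0) :
    combination n a b c E D F =
      ∑ r ∈ Icc 1 n, (a r * b r * c r * F r - S a b c 0 r r * (E r / (r : ℂ) ^ 2 + D r / (r : ℂ))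
        + S a b c 0 0 r * (E r / (r : ℂ) ^ 2)) +
      ∑ r ∈ Icc 2 n, ∑ l ∈ Icc 1 (r - 1),
        ((S a b c r r l - S a b c l l r) * ((E l - E r) / ((r : ℂ) - l) ^ 2)
          - (S a b c r r l * D r - S a b c l l r * D l) / ((r : ℂ) - l)) +
      tripleSum n a b c E := by
  rw [combination, sum_range_pairs, ← sum_Icc_one_eq_range _ _ (by simp [hF]), ← add_assoc,
    ← sum_add_distrib]
  congr 2
  refine sum_congr rfl fun r _ => ?_
  rw [S_comm _ _ _ 0 r r, hE, hD]
  push_cast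
  ring

/-- These are the weights attached to `(-1)^j z (u+1-j)` in the three closed forms. With `s = u + 4`
that is the zeta value of index `s - (j+3)`, and the two signs cancel. -/
lemma combination_weight (j : ℕ) :
    combination n a b c (weight (fun _ => 1) (j + 1))
      (fun r => ((j : ℂ) + 1) * weight (fun _ => 1) (j + 2) r)
      (fun r => ((j : ℂ) + 1) * ((j : ℂ) + 2) / 2 * weight (fun _ => 1) (j + 3) r) =
    (-1) ^ j * general n a b c (j + 3) := by
  rw [combination_of_vanishing _ _ _ _ (by simp [weight]) (by simp [weight]) (by simp [weight]),
    general, ← mul_assoc]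
  have h : (-1 : ℂ) ^ j * (-1) ^ (j + 3 - 1) = 1 := by
    rw [show j + 3 - 1 = j + 2 from rfl, ← pow_add, show j + (j + 2) = 2 * (j + 1) by ring,
      pow_mul]
    simp
  rw [h, one_mul, show j + 3 - 2 = j + 1 from rfl, show j + 3 - 1 = j + 2 from rfl]
  congr 2
  · refine sum_congr rfl fun r hr => ?_
    simp only [mem_Icc] at hr
    have h1 : (r : ℂ) ≠ 0 := by exact_mod_cast (by omega : r ≠ 0)
    simp only [weight, show r ≠ 0 by omega, if_false]
    push_cast
    field_simp
    ring
  · refine sum_congr rfl fun r hr => sum_congr rfl fun l hl => ?_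
    simp only [mem_Icc] at hr hl
    simp only [weight, show r ≠ 0 by omega, show l ≠ 0 by omega, if_false]
    push_cast
    ring

/-- The contribution of `ζ(2)` not captured by the generic coefficients. -/
noncomputable def zetaTwoPart (u : ℕ) : ℂ :=
  combination n a b c (fun _ => 0) (weight (fun _ => 1) (u + 1))
    (fun r => ((u : ℂ) + 1) * weight (fun _ => 1) (u + 2) r)

/-- The contribution of harmonic numbers. -/
noncomputable def harmonicPart (u : ℕ) : ℂ :=
  combination n a b c (weight (H 1) (u + 1))
    (fun r => ((u : ℂ) + 1) * weight (H 1) (u + 2) r + weight (H 2) (u + 1) r)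
    (fun r => ((u : ℂ) + 1) * ((u : ℂ) + 2) / 2 * weight (H 1) (u + 3) r
        + ((u : ℂ) + 1) * weight (H 2) (u + 2) r + weight (H 3) (u + 1) r)

/-- Triple poles come only from the diagonal, hence only `a r * b r * c r` appears. -/
lemma combination_zetaThree (u : ℕ) :
    combination n a b c (fun _ => 0) (fun _ => 0) (weight (fun _ => 1) (u + 1)) =
      ∑ r ∈ Icc 1 n, a r * b r * c r / (r : ℂ) ^ (u + 1) := by
  rw [combination_of_vanishing _ _ _ _ rfl rfl (by simp [weight]), tripleSum_zero]
  simp only [sub_self, zero_div, mul_zero, sum_const_zero, add_zero, sub_zero]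
  refine sum_congr rfl fun r hr => ?_
  simp only [mem_Icc] at hr
  simp [weight, show r ≠ 0 by omega, div_eq_mul_inv]

/-! ### Collecting coefficients for `s ≥ 4` -/

lemma combination_series (z : ℕ → ℂ) (u : ℕ) :
    combination n a b c (simpleSeries z u) (doubleSeries z u) (tripleSeries z u) =
      a 0 * b 0 * c 0 * z (u + 4) + (∑ r ∈ Icc 1 n, S a b c 0 0 r / (r : ℂ)) * z (u + 3)
        + second n a b c * z (u + 2) + ∑ j ∈ range u, general n a b c (j + 3) * z (u + 1 - j)
        - (-1) ^ u * (zetaTwoPart n a b c u * z 2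
          + (∑ r ∈ Icc 1 n, a r * b r * c r / (r : ℂ) ^ (u + 1)) * z 3
          - harmonicPart n a b c u) := by
  -- The zero summands give all three families the same shape, so that linearity applies to them
  -- simultaneously.
  have h1 : (simpleSeries z u) = fun r => (if r = 0 then z (u + 2) else 0) +
      (∑ j ∈ range u, (-1) ^ j * z (u + 1 - j) * weight (fun _ => 1) (j + 1) r +
      (-1) ^ u * (weight (H 1) (u + 1) r + (-z 2 * 0 + -z 3 * 0))) := by
    funext r
    rw [simpleSeries]
    ring
  have h2 : (doubleSeries z u) = fun r => (if r = 0 then z (u + 3) else 0) +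
      (∑ j ∈ range u, (-1) ^ j * z (u + 1 - j) *
        (((j : ℂ) + 1) * weight (fun _ => 1) (j + 2) r) +
      (-1) ^ u * ((((u : ℂ) + 1) * weight (H 1) (u + 2) r + weight (H 2) (u + 1) r) +
        (-z 2 * weight (fun _ => 1) (u + 1) r + -z 3 * 0))) := by
    funext r
    rw [doubleSeries]
    ring
  have h3 : (tripleSeries z u) = fun r => (if r = 0 then z (u + 4) else 0) +
      (∑ j ∈ range u, (-1) ^ j * z (u + 1 - j) *
        (((j : ℂ) + 1) * ((j : ℂ) + 2) / 2 * weight (fun _ => 1) (j + 3) r) +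
      (-1) ^ u * ((((u : ℂ) + 1) * ((u : ℂ) + 2) / 2 * weight (H 1) (u + 3) r
        + ((u : ℂ) + 1) * weight (H 2) (u + 2) r + weight (H 3) (u + 1) r) +
        (-z 2 * (((u : ℂ) + 1) * weight (fun _ => 1) (u + 2) r)
        + -z 3 * weight (fun _ => 1) (u + 1) r))) := by
    funext r
    rw [tripleSeries]
    ring
  rw [h1, h2, h3, combination_add, combination_indicator, combination_add,
    combination_sum n a b c (fun j => (-1) ^ j * z (u + 1 - j))
      (fun j r => weight (fun _ => 1) (j + 1) r)
      (fun j r => ((j : ℂ) + 1) * weight (fun _ => 1) (j + 2) r)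
      (fun j r => ((j : ℂ) + 1) * ((j : ℂ) + 2) / 2 * weight (fun _ => 1) (j + 3) r),
    combination_smul, combination_add, combination_add, combination_smul, combination_smul,
    combination_zetaThree]
  have h4 : ∀ j ∈ range u, (-1) ^ j * z (u + 1 - j) *
      combination n a b c (fun r => weight (fun _ => 1) (j + 1) r)
      (fun r => ((j : ℂ) + 1) * weight (fun _ => 1) (j + 2) r)
      (fun r => ((j : ℂ) + 1) * ((j : ℂ) + 2) / 2 * weight (fun _ => 1) (j + 3) r) =
      general n a b c (j + 3) * z (u + 1 - j) := fun j _ => by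
    have e : (-1 : ℂ) ^ j * (-1) ^ j = 1 := by rw [← mul_pow]; simp
    have := combination_weight n a b c j
    rw [this]
    linear_combination (general n a b c (j + 3) * z (u + 1 - j)) * e
  rw [sum_congr rfl h4]
  simp only [zetaTwoPart, harmonicPart]
  ring

lemma I_add_four (z : ℕ → ℂ)
    (hz : ∀ p, 2 ≤ p → HasSum (fun k : ℕ => 1 / ((k : ℂ) + 1) ^ p) (z p)) (u : ℕ) :
    I n a b c (u + 4) (by omega) =
      a 0 * b 0 * c 0 * z (u + 4) + (∑ r ∈ Icc 1 n, S a b c 0 0 r / (r : ℂ)) * z (u + 3)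
        + second n a b c * z (u + 2) + ∑ j ∈ range u, general n a b c (j + 3) * z (u + 1 - j)
        - (-1) ^ u * (zetaTwoPart n a b c u * z 2
          + (∑ r ∈ Icc 1 n, a r * b r * c r / (r : ℂ) ^ (u + 1)) * z 3
          - harmonicPart n a b c u) := by
  rw [← combination_series]
  exact I_eq_combination n a b c (u + 1) (fun _ => 0) _ _ _
    (fun i => by simpa only [sub_zero] using hasSum_simpleSeries hz u i)
    (hasSum_doubleSeries hz u) (hasSum_tripleSeries hz u)

/-- For `s = 4` the index `s - 2` is 2, so `second` also contributes to the coefficient of `ζ(2)`.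
-/
lemma zetaTwoPart_zero : zetaTwoPart n a b c 0 = second n a b c + A42 n a b c := by
  rw [zetaTwoPart, combination_of_vanishing _ _ _ _ rfl (by simp [weight]) (by simp [weight]),
    tripleSum_zero, second, A42, add_zero]
  have h1 : ∀ v w v' w' : ℂ, v - w + (v' + w') = (v + v') + (w' - w) := by intros; ring
  rw [h1]
  simp only [← sum_add_distrib, ← sum_sub_distrib]
  congr 1
  · refine sum_congr rfl fun r hr => ?_
    simp only [mem_Icc] at hr
    have h1 : (r : ℂ) ≠ 0 := by exact_mod_cast (by omega : r ≠ 0)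
    simp only [weight, show r ≠ 0 by omega, if_false]
    push_cast
    field_simp
    ring
  · refine sum_congr rfl fun r hr => sum_congr rfl fun l hl => ?_
    simp only [mem_Icc] at hr hl
    simp only [weight, show r ≠ 0 by omega, show l ≠ 0 by omega, if_false]
    push_cast
    ring

/-- `A4` is the formula for `A1` at `s = 4` in another arrangement, hence the separate comparison.
-/
lemma harmonicPart_zero : harmonicPart n a b c 0 = -A4 n a b c := by
  rw [harmonicPart, combination_of_vanishing _ _ _ _ (by simp [weight]) (by simp [weight])
    (by simp [weight]), A4, neg_sub, sub_eq_add_neg, add_comm (tripleSum _ _ _ _ _), neg_add]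
  simp only [← sum_neg_distrib]
  congr 2
  · refine sum_congr rfl fun r hr => ?_
    simp only [mem_Icc] at hr
    have h1 : (r : ℂ) ≠ 0 := by exact_mod_cast (by omega : r ≠ 0)
    simp only [weight, show r ≠ 0 by omega, if_false]
    push_cast
    field_simp
    ring
  · refine sum_congr rfl fun r hr => sum_congr rfl fun l hl => ?_
    simp only [mem_Icc] at hr hl
    simp only [weight, show r ≠ 0 by omega, show l ≠ 0 by omega, if_false]
    push_cast
    ring

lemma harmonicPart_eq (u : ℕ) : (-1) ^ u * harmonicPart n a b c u = -A1 n a b c (u + 4) := by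
  rw [harmonicPart, combination_of_vanishing _ _ _ _ (by simp [weight]) (by simp [weight])
    (by simp [weight]), A1, pow_add]
  simp only [show u + 4 - 3 = u + 1 from rfl, show u + 4 - 2 = u + 2 from rfl,
    show u + 4 - 1 = u + 3 from rfl]
  rw [mul_assoc ((-1 : ℂ) ^ u), ← mul_neg]
  congr 1
  have h1 : ∀ v w x : ℂ, -((-1) ^ 4 * (v - w - x)) = -v + w + x := by intros; ring
  rw [h1]
  simp only [← sum_neg_distrib]
  congr 2
  · refine sum_congr rfl fun r hr => ?_
    simp only [mem_Icc] at hr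
    have h1 : (r : ℂ) ≠ 0 := by exact_mod_cast (by omega : r ≠ 0)
    simp only [weight, show r ≠ 0 by omega, if_false]
    push_cast
    field_simp
    ring
  · refine sum_congr rfl fun r hr => sum_congr rfl fun l hl => ?_
    simp only [mem_Icc] at hr hl
    simp only [weight, show r ≠ 0 by omega, show l ≠ 0 by omega, if_false]
    push_cast
    ring

/-- For `s = u + 5` the last generic term also multiplies `ζ(2)`, and the two contributions merge.
The triple sum comes from `general` alone, since `zetaTwoPart` has no simple-pole component. -/
lemma general_sub_zetaTwoPart (u : ℕ) :
    general n a b c (u + 3) - (-1) ^ (u + 1) * zetaTwoPart n a b c (u + 1) =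
      -A12 n a b c (u + 5) := by
  rw [zetaTwoPart, combination_of_vanishing _ _ _ _ rfl (by simp [weight]) (by simp [weight]),
    tripleSum_zero, general, A12]
  simp only [show u + 5 - 3 = u + 2 from rfl, show u + 5 - 2 = u + 3 from rfl,
    show u + 5 - 4 = u + 1 from rfl, show u + 3 - 2 = u + 1 from rfl,
    show u + 3 - 1 = u + 2 from rfl]
  have h1 : ∀ v w x v' w' v'' w'' : ℂ, v + v' = v'' → w + w' = w'' →
      (-1) ^ (u + 2) * (v + w + x) - (-1) ^ (u + 1) * (v' + w' + 0) =
        -((-1) ^ (u + 5) * (v'' + w'' + x)) := by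
    rintro v w x v' w' _ _ rfl rfl
    ring
  apply h1 <;> simp only [← sum_add_distrib]
  · refine sum_congr rfl fun r hr => ?_
    simp only [mem_Icc] at hr
    have h1 : (r : ℂ) ≠ 0 := by exact_mod_cast (by omega : r ≠ 0)
    simp only [weight, show r ≠ 0 by omega, if_false]
    push_cast
    field_simp
    ring
  · refine sum_congr rfl fun r hr => sum_congr rfl fun l hl => ?_
    simp only [mem_Icc] at hr hl
    simp only [weight, show r ≠ 0 by omega, show l ≠ 0 by omega, if_false]
    push_cast
    ring

/-- The indices 3 and `s - 2` coincide when `s = 5`, so the contribution special to `ζ(3)` is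
detached before the top index is peeled off. The rest is the reflection `m = u + 2 - j`. -/
lemma sum_A1m (z : ℕ → ℂ) (u : ℕ) :
    ∑ m ∈ Icc 3 (u + 5), A1m n a b c (u + 5) m * z m =
      a 0 * b 0 * c 0 * z (u + 5) + (∑ r ∈ Icc 1 n, S a b c 0 0 r / (r : ℂ)) * z (u + 4)
        + second n a b c * z (u + 3) + ∑ j ∈ range u, general n a b c (j + 3) * z (u + 2 - j)
        + extra n a b c (u + 5) * z 3 := by
  rw [sum_Icc_succ_top (by omega), sum_Icc_succ_top (by omega)]
  have h1 : ∀ m ∈ Icc 3 (u + 3), A1m n a b c (u + 5) m * z m =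
      (if m = u + 3 then second n a b c else general n a b c (u + 5 - m)) * z m
        + (if m = 3 then extra n a b c (u + 5) * z 3 else 0) := fun m hm => by
    simp only [mem_Icc] at hm
    simp only [A1m, show m ≠ u + 5 by omega, show u + 5 - 1 = u + 4 from rfl,
      show m ≠ u + 4 by omega, show m ≠ 2 by omega, if_false, show u + 5 - 2 = u + 3 from rfl,
      add_mul]
    split_ifs with h2 h3 h3 <;> first | rw [h3] | rw [zero_mul]
  rw [sum_congr rfl h1, sum_add_distrib, sum_ite_eq' _ 3, if_pos (by simp),
    sum_Icc_succ_top (by omega)]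
  have h2 : ∑ m ∈ Icc 3 (u + 2), (if m = u + 3 then second n a b c else
      general n a b c (u + 5 - m)) * z m =
        ∑ j ∈ range u, general n a b c (j + 3) * z (u + 2 - j) := by
    refine sum_bij' (fun m _ => u + 2 - m) (fun j _ => u + 2 - j) ?_ ?_ ?_ ?_ ?_ <;>
      simp only [mem_Icc, mem_range]
    · intros; omega
    · intros; omega
    · intros; omega
    · intros; omega
    · intro m hm
      rw [if_neg (by omega), show u + 2 - (u + 2 - m) = m by omega,
        show u + 2 - m + 3 = u + 5 - m by omega]
  rw [h2]
  simp only [A1m, if_true, show u + 5 - 1 = u + 4 from rfl, show u + 4 ≠ u + 5 by omega, if_false]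
  ring

/-! ### The case `s = 3` -/

lemma I_three (z : ℕ → ℂ)
    (hz : ∀ p, 2 ≤ p → HasSum (fun k : ℕ => 1 / ((k : ℂ) + 1) ^ p) (z p)) :
    I n a b c 3 le_rfl = A33 n a b c * z 3 - A32 n a b c * z 2 - A3 n a b c := by
  -- No power of `k + 1` is left to make the simple-pole series converge, so `κ k = 1 / (k + 1)` is
  -- subtracted.
  refine (I_eq_combination n a b c 0 (fun k => 1 / ((k : ℂ) + 1)) (fun r => -H 1 r)
    (fun r => z 2 - H 2 r) (fun r => z 3 - H 3 r)
    (fun i => by simpa using hasSum_harmonic i)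
    (fun i => by simpa using hasSum_shift (hz 2 le_rfl) i)
    (fun i => by simpa using hasSum_shift (hz 3 (by norm_num)) i)).trans ?_
  rw [combination, A33, A32, A3, sum_Icc_one_eq_range _ _ (by simp),
    sum_Icc_one_eq_range _ _ (by simp), sum_Icc_one_eq_range _ _ (by simp)]
  have h1 : tripleSum n a b c (fun r => -H 1 r) = -tripleSum n a b c (H 1) := by
    simpa using tripleSum_smul n a b c (-1) (H 1)
  rw [h1]
  have h2 : ∑ r ∈ range (n + 1), a r * b r * c r * (z 3 - H 3 r) =
      (∑ r ∈ range (n + 1), a r * b r * c r) * z 3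
        - ∑ r ∈ range (n + 1), a r * b r * c r * H 3 r := by
    simp only [mul_sub, sum_sub_distrib, sum_mul]
  rw [h2]
  have h3 : ∀ (p q : ℂ) {v w x : ℂ}, v = -w * z 2 + x → p - q + v + -tripleSum n a b c (H 1) =
      p - w * z 2 - (q - x + tripleSum n a b c (H 1)) := by
    rintro p q v w x rfl
    ring
  apply h3
  rw [neg_mul, sum_mul, ← sum_neg_distrib, ← sum_add_distrib]
  refine sum_congr rfl fun r _ => ?_
  rw [sum_mul, ← sum_neg_distrib, ← sum_add_distrib]
  refine sum_congr rfl fun l _ => ?_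
  ring

end ZetaForms

theorem theorem1 (n : ℕ) (hn : 1 ≤ n) (a b c : ℕ → ℂ) :
    (∀ (s : ℕ) (hs : 3 ≤ s),
      IntegrableOn (ZetaForms.integrand n a b c s hs) (Set.Icc (0 : Fin s → ℝ) 1)) ∧
    ZetaForms.I n a b c 3 (by norm_num) =
      ZetaForms.A33 n a b c * riemannZeta 3 - ZetaForms.A32 n a b c * riemannZeta 2
        - ZetaForms.A3 n a b c ∧
    ZetaForms.I n a b c 4 (by norm_num) =
      ZetaForms.A44 a b c * riemannZeta 4 + ZetaForms.A43 n a b c * riemannZeta 3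
        - ZetaForms.A42 n a b c * riemannZeta 2 - ZetaForms.A4 n a b c ∧
    ∀ (s : ℕ) (hs : 5 ≤ s),
      ZetaForms.I n a b c s (by omega) =
        ∑ m ∈ Finset.Icc 3 s, ZetaForms.A1m n a b c s m * riemannZeta (m : ℂ)
          - ZetaForms.A1m n a b c s 2 * riemannZeta 2 - ZetaForms.A1 n a b c s := by
  -- An opaque function on `ℕ` keeps casts in the argument of zeta out of the algebra.
  obtain ⟨z, hzeta⟩ : ∃ z : ℕ → ℂ, ∀ p : ℕ, riemannZeta p = z p := ⟨_, fun _ => rfl⟩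
  have hz : ∀ p, 2 ≤ p → HasSum (fun k : ℕ => 1 / ((k : ℂ) + 1) ^ p) (z p) := fun p hp =>
    hzeta p ▸ ZetaForms.hasSum_riemannZeta hp
  have h2 : riemannZeta 2 = z 2 := by exact_mod_cast hzeta 2
  have h3 : riemannZeta 3 = z 3 := by exact_mod_cast hzeta 3
  have h4 : riemannZeta 4 = z 4 := by exact_mod_cast hzeta 4
  refine ⟨fun s hs => ?_, ?_, ?_, fun s hs => ?_⟩
  · obtain ⟨t, rfl⟩ : ∃ t, s = t + 3 := ⟨s - 3, by omega⟩
    exact (ZetaForms.integrand_and_hasSum n a b c t).1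
  · rw [h2, h3]
    exact ZetaForms.I_three n a b c z hz
  · rw [h2, h3, h4]
    have h := ZetaForms.I_add_four n a b c z hz 0
    simp only [zero_add, pow_zero, pow_one, range_zero, sum_empty, add_zero, one_mul,
      ZetaForms.zetaTwoPart_zero, ZetaForms.harmonicPart_zero] at h
    rw [h, ZetaForms.A44, ZetaForms.A43]
    simp only [sub_div, sum_sub_distrib]
    ring
  · obtain ⟨u, rfl⟩ : ∃ u, s = u + 5 := ⟨s - 5, by omega⟩
    have h := ZetaForms.I_add_four n a b c z hz (u + 1)
    simp only [h2, hzeta]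
    rw [ZetaForms.sum_A1m]
    have e1 := ZetaForms.harmonicPart_eq n a b c (u + 1)
    have e2 := ZetaForms.general_sub_zetaTwoPart n a b c u
    have e3 : ZetaForms.A1m n a b c (u + 5) 2 = ZetaForms.A12 n a b c (u + 5) := by
      simp [ZetaForms.A1m]
    have e4 : ZetaForms.extra n a b c (u + 5) =
        -(-1) ^ (u + 1) * ∑ r ∈ Icc 1 n, a r * b r * c r / (r : ℂ) ^ (u + 2) := by
      rw [ZetaForms.extra, show u + 5 - 3 = u + 2 from rfl]
      ring
    -- The term `j = u` multiplies `z 2` and is detached to be merged with `zetaTwoPart` through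
    -- `e2`.
    rw [sum_range_succ, show u + 1 + 1 - u = 2 by omega] at h
    rw [e3, e4]
    refine h.trans ?_
    linear_combination e1 + z 2 * e2
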